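/- Let $u\in\mathbb{C}[t]$ be a polynomial of degree exactly $2$ (its roots may be simple or double), and let $q,n\in\mathbb{Z}$ with $q^2\neq 1$, $n$ odd and $|n|<2|q|$. Then all the solutions of the Riccati equation $$y'=y^2+\frac{1-q^2}{4}\,\frac{(u')^2-2uu''}{u^2}+\frac{1-n^2}{8}\,\frac{u''}{u}$$ are meromorphic on $\mathbb{C}$, and indeed rational. That is: if $U\subset\mathbb{C}$ is a nonempty connected open set containing no zero of $u$ and $y\colon U\to\mathbb{C}$ is a holomorphic solution of the equation, then there is a rational function $R\in\mathbb{C}(t)$ such that $y=R$ on $U$ and such that $R$, as a meromorphic function on $\mathbb{C}$, satisfies the equation at every point that is neither a zero of $u$ nor a pole of $R$. -/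

import Mathlib

open Polynomial

noncomputable section

/-- The rational function
`(1 - q²)/4 · ((u')² - 2 u u'')/u² + (1 - n²)/8 · u''/u`, evaluated at `t`
(only used at points where `u` does not vanish). -/
def riccatiCoeff (q n : ℤ) (u : ℂ[X]) (t : ℂ) : ℂ :=
  (1 - (q : ℂ) ^ 2) / 4 *
      (((derivative u).eval t ^ 2 - 2 * u.eval t * (derivative (derivative u)).eval t)
        / u.eval t ^ 2)
    + (1 - (n : ℂ) ^ 2) / 8 * ((derivative (derivative u)).eval t / u.eval t)

/-- On the set `U`, the function `y` is a (complex-differentiable) solution of the Riccati equation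
`y' = y² + (1 - q²)/4 · ((u')² - 2 u u'')/u² + (1 - n²)/8 · u''/u`; the set `U` has to avoid
the zeros of `u`, where the equation is not defined. -/
def IsRiccatiSolutionOn (q n : ℤ) (u : ℂ[X]) (y : ℂ → ℂ) (U : Set ℂ) : Prop :=
  ∀ t ∈ U, u.eval t ≠ 0 ∧ HasDerivAt y (y t ^ 2 + riccatiCoeff q n u t) t

/-- The function `ℂ → ℂ` given by a rational function (in lowest terms; the value at the finitely
many poles is `0`). -/
def ratFun (R : RatFunc ℂ) (t : ℂ) : ℂ := R.eval (RingHom.id ℂ) t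

end

open Polynomial

/-! Writing the equation as `y' = y² + r`, put `y = -w'/w`, so that `w'' + r w = 0`. With `|n| =
2k+1`, `|q| = e+k+1` and `w = u^s P`, where `s = (1-|q|)/2` is an exponent at a simple root of `u`,
this becomes a Gegenbauer equation for `P`, uniformly in the discriminant `δ`. Its exponents at
infinity give degrees `e` and `e+2k+1`; as these have opposite parity, both are realised by
polynomials, which span the solutions. Hence every `y` is `-s u'/u - P'/P` for a polynomial `P`,
which is rational. -/

theorem exists_monic_gegenbauer (h δ : ℂ) (d d' : ℕ) (hd : Odd (d + d')) :
    ∃ P : ℂ[X], P.Monic ∧ P.natDegree = d ∧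
      ((X + C h) ^ 2 - C δ) * derivative (derivative P)
        - ((d : ℂ[X]) + (d' : ℂ[X]) - 1) * (X + C h) * derivative P + (d : ℂ[X]) * (d' : ℂ[X]) * P = 0 := by
  have hY (i : ℕ) : ((X + C h) ^ i : ℂ[X]).natDegree = i := by
    rw [natDegree_pow, natDegree_X_add_C, mul_one]
  -- Descending series from `(X+h)^d` in steps of two, cut at exponent `i`: only one residual term
  -- is left, and it vanishes once `i` is 0 or 1.
  have partialSum : ∀ j i : ℕ, i + 2 * j = d → ∃ (P : ℂ[X]) (b : ℂ), P.Monic ∧ P.natDegree = d ∧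
      ((X + C h) ^ 2 - C δ) * derivative (derivative P)
        - ((d : ℂ[X]) + (d' : ℂ[X]) - 1) * (X + C h) * derivative P + (d : ℂ[X]) * (d' : ℂ[X]) * P
        = C b * (i : ℂ[X]) * ((i - 1 : ℕ) : ℂ[X]) * (X + C h) ^ (i - 2) := by
    have hL (i : ℕ) : ((X + C h) ^ 2 - C δ) * derivative (derivative ((X + C h) ^ i))
        - ((d : ℂ[X]) + (d' : ℂ[X]) - 1) * (X + C h) * derivative ((X + C h) ^ i)
        + (d : ℂ[X]) * (d' : ℂ[X]) * (X + C h) ^ i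
        = ((i : ℂ[X]) - (d : ℂ[X])) * ((i : ℂ[X]) - (d' : ℂ[X])) * (X + C h) ^ i
          - C δ * (i : ℂ[X]) * ((i - 1 : ℕ) : ℂ[X]) * (X + C h) ^ (i - 2) := by
      rcases i with _ | _ | i
      · simp
      · simp
        ring
      · simp [derivative_pow, derivative_mul]
        ring
    intro j
    induction j with
    | zero =>
      intro i hi
      obtain rfl : i = d := by omega
      refine ⟨(X + C h) ^ i, -δ, (monic_X_add_C h).pow i, hY i, ?_⟩
      rw [hL]
      simp
    | succ j ih =>
      intro i hi
      obtain ⟨P, b, hm, hdeg, hP⟩ := ih (i + 2) (by omega)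
      have h1 : (i : ℂ) - d ≠ 0 := by
        rw [sub_ne_zero]
        exact_mod_cast (by omega : i ≠ d)
      -- No resonance: `i` has the parity of `d`, and `d'` the other one.
      have h2 : (i : ℂ) - d' ≠ 0 := by
        rw [sub_ne_zero]
        obtain ⟨m, hm⟩ := hd
        exact_mod_cast (by omega : i ≠ d')
      set b' : ℂ := -(b * (i + 2) * (i + 1)) / ((i - d) * (i - d')) with hb'
      have hb : b * (i + 2) * (i + 1) + b' * ((i - d) * (i - d')) = 0 := by
        rw [hb']
        field_simp
        ring
      have hlt : (C b' * (X + C h) ^ i).degree < P.degree := by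
        refine degree_lt_degree ((natDegree_C_mul_le _ _).trans_lt ?_)
        rw [hY, hdeg]
        omega
      refine ⟨P + C b' * (X + C h) ^ i, -(δ * b'), hm.add_of_left hlt, ?_, ?_⟩
      · rw [natDegree_add_eq_left_of_degree_lt hlt, hdeg]
      · have hC := congrArg (C : ℂ → ℂ[X]) hb
        simp only [map_add, map_mul, map_sub, map_natCast, map_ofNat, map_one, map_zero] at hC
        have hLi := hL i
        simp only [derivative_add, derivative_C_mul, map_neg, map_mul]
        simp only [Nat.add_sub_cancel, Nat.cast_add, Nat.cast_ofNat,
          show i + 2 - 1 = i + 1 from rfl, Nat.cast_one] at hP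
        linear_combination hP + C b' * hLi + (X + C h) ^ i * hC
  obtain ⟨m, hm⟩ | ⟨m, hm⟩ := d.even_or_odd
  · obtain ⟨P, b, h1, h2, h3⟩ := partialSum m 0 (by omega)
    exact ⟨P, h1, h2, by simpa using h3⟩
  · obtain ⟨P, b, h1, h2, h3⟩ := partialSum m 1 (by omega)
    exact ⟨P, h1, h2, by simpa using h3⟩

/-- `g` may have no primitive on `U`, so `F * exp (-G)` is shown constant on a ball only; the
identity theorem does the rest. -/
theorem eqOn_zero_of_hasDerivAt_mul {U : Set ℂ} (hUo : IsOpen U) (hUc : IsPreconnected U)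
    {F g : ℂ → ℂ} (hg : DifferentiableOn ℂ g U) (hF : ∀ t ∈ U, HasDerivAt F (g t * F t) t)
    {t₀ : ℂ} (ht₀ : t₀ ∈ U) (h0 : F t₀ = 0) : Set.EqOn F 0 U := by
  have hFU : AnalyticOnNhd ℂ F U :=
    DifferentiableOn.analyticOnNhd (fun t ht => (hF t ht).differentiableAt.differentiableWithinAt)
      hUo
  refine hFU.eqOn_zero_of_preconnected_of_eventuallyEq_zero hUc ht₀ ?_
  obtain ⟨r, hr, hball⟩ := Metric.isOpen_iff.1 hUo t₀ ht₀
  obtain ⟨G, hG⟩ := (hg.mono hball).isExactOn_ball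
  have hK : ∀ t ∈ Metric.ball t₀ r, HasDerivAt (fun t => F t * Complex.exp (-G t)) 0 t := by
    intro t ht
    refine ((hF t (hball ht)).mul ((hG t ht).neg.cexp)).congr_deriv ?_
    simp only [Pi.neg_apply]
    ring
  filter_upwards [Metric.ball_mem_nhds t₀ hr] with t ht
  have := (convex_ball t₀ r).is_const_of_fderivWithin_eq_zero (𝕜 := ℂ)
    (fun x hx => (hK x hx).differentiableAt.differentiableWithinAt)
    (fun x hx => by
      rw [fderivWithin_of_isOpen Metric.isOpen_ball hx]
      ext
      simp [(hK x hx).deriv]) ht (Metric.mem_ball_self hr)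
  simpa [h0, Complex.exp_ne_zero] using this

theorem derivative_derivative_eval_of_gegenbauer {q n : ℤ} {e k : ℕ} {a h δ t : ℂ} {P : ℂ[X]}
    (hq : (q : ℂ) ^ 2 = ((e : ℂ) + k + 1) ^ 2) (hn : (n : ℂ) ^ 2 = (2 * (k : ℂ) + 1) ^ 2)
    (hP : ((X + C h) ^ 2 - C δ) * derivative (derivative P)
        - ((e : ℂ[X]) + ((e + 2 * k + 1 : ℕ) : ℂ[X]) - 1) * (X + C h) * derivative P
        + (e : ℂ[X]) * ((e + 2 * k + 1 : ℕ) : ℂ[X]) * P = 0)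
    {u : ℂ[X]} (hu : u = C a * ((X + C h) ^ 2 - C δ)) (ht : u.eval t ≠ 0) :
    (derivative (derivative P)).eval t =
      -(2 * (-((e : ℂ) + k) / 2 * (derivative u).eval t / u.eval t)) * (derivative P).eval t
      - (-((e : ℂ) + k) / 2 * (derivative (derivative u)).eval t / u.eval t
          + (-((e : ℂ) + k) / 2) * (-((e : ℂ) + k) / 2 - 1) * (derivative u).eval t ^ 2
            / u.eval t ^ 2
          + riccatiCoeff q n u t) * P.eval t := by
  have hu0 : u.eval t = a * ((t + h) ^ 2 - δ) := by simp [hu]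
  have hu1 : (derivative u).eval t = a * (2 * (t + h)) := by simp [hu, derivative_pow]
  have hu2 : (derivative (derivative u)).eval t = a * 2 := by simp [hu, derivative_pow]
  have hPt := congrArg (eval t) hP
  simp only [eval_add, eval_sub, eval_mul, eval_pow, eval_X, eval_C, eval_natCast, eval_ofNat, eval_one,
    eval_zero, Nat.cast_add, Nat.cast_mul, Nat.cast_ofNat, Nat.cast_one] at hPt
  rw [hu0] at ht
  have ha : a ≠ 0 := left_ne_zero_of_mul ht
  have hb : (t + h) ^ 2 - δ ≠ 0 := right_ne_zero_of_mul ht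
  rw [riccatiCoeff, hu0, hu1, hu2, hq, hn]
  field_simp
  linear_combination 32 * ((t + h) ^ 2 - δ) * hPt

/-- With `v = s u'/u` and `w = u^s P`, the function is `u^(-s) (w' + y w)`, which measures the
failure of `y = -w'/w`. The equation for `P` reads `P'' + 2vP' + (v' + v² + r)P = 0`, so the terms
in `r` and `v'` cancel. -/
theorem eval_add_mul_hasDerivAt {q n : ℤ} {u P : ℂ[X]} {s t : ℂ} {y : ℂ → ℂ} (ht : u.eval t ≠ 0)
    (hP : (derivative (derivative P)).eval t =
      -(2 * (s * (derivative u).eval t / u.eval t)) * (derivative P).eval t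
      - (s * (derivative (derivative u)).eval t / u.eval t
          + s * (s - 1) * (derivative u).eval t ^ 2 / u.eval t ^ 2
          + riccatiCoeff q n u t) * P.eval t)
    (hy : HasDerivAt y (y t ^ 2 + riccatiCoeff q n u t) t) :
    HasDerivAt (fun t => (derivative P).eval t + (y t + s * (derivative u).eval t / u.eval t) *
        P.eval t)
      ((y t - s * (derivative u).eval t / u.eval t) *
        ((derivative P).eval t + (y t + s * (derivative u).eval t / u.eval t) * P.eval t)) t := by
  have hv := (((derivative u).hasDerivAt t).const_mul s).div (u.hasDerivAt t) ht
  refine (((derivative P).hasDerivAt t).add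
    ((hy.add hv).mul (P.hasDerivAt t))).congr_deriv ?_
  simp only [Pi.add_apply, Pi.div_apply, hP]
  field_simp
  ring

theorem hasDerivAt_neg_logDeriv {q n : ℤ} {u P : ℂ[X]} {s t : ℂ} (ht : u.eval t ≠ 0)
    (hPt : P.eval t ≠ 0)
    (hP : (derivative (derivative P)).eval t =
      -(2 * (s * (derivative u).eval t / u.eval t)) * (derivative P).eval t
      - (s * (derivative (derivative u)).eval t / u.eval t
          + s * (s - 1) * (derivative u).eval t ^ 2 / u.eval t ^ 2
          + riccatiCoeff q n u t) * P.eval t) :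
    HasDerivAt (fun t => -(s * (derivative u).eval t / u.eval t) -
        (derivative P).eval t / P.eval t)
      ((-(s * (derivative u).eval t / u.eval t) - (derivative P).eval t / P.eval t) ^ 2
        + riccatiCoeff q n u t) t := by
  have hv := (((derivative u).hasDerivAt t).const_mul s).div (u.hasDerivAt t) ht
  refine (hv.neg.sub
    (((derivative P).hasDerivAt t).div (P.hasDerivAt t) hPt)).congr_deriv ?_
  rw [hP]
  field_simp
  ring

theorem ratFun_eq (R : RatFunc ℂ) : ratFun R = fun t => R.num.eval t / R.denom.eval t := by
  funext t
  simp [ratFun, RatFunc.eval, eval₂_id]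

theorem meromorphic_ratFun (R : RatFunc ℂ) : Meromorphic (ratFun R) := by
  rw [ratFun_eq]
  intro t
  exact (R.num.differentiable.analyticAt t).meromorphicAt.div
    (R.denom.differentiable.analyticAt t).meromorphicAt

theorem differentiableAt_ratFun {R : RatFunc ℂ} {t : ℂ} (ht : R.denom.eval t ≠ 0) :
    DifferentiableAt ℂ (ratFun R) t := by
  rw [ratFun_eq]
  exact R.num.differentiableAt.div R.denom.differentiableAt ht

theorem ratFun_div_mul {p d : ℂ[X]} (hd : d ≠ 0) {t : ℂ}
    (ht : (algebraMap ℂ[X] (RatFunc ℂ) p / algebraMap ℂ[X] (RatFunc ℂ) d).denom.eval t ≠ 0) :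
    ratFun (algebraMap ℂ[X] (RatFunc ℂ) p / algebraMap ℂ[X] (RatFunc ℂ) d) t * d.eval t
      = p.eval t := by
  have := congrArg (eval t) ((RatFunc.num_mul_eq_mul_denom_iff hd).2
    (rfl : algebraMap ℂ[X] (RatFunc ℂ) p / algebraMap ℂ[X] (RatFunc ℂ) d = _))
  rw [eval_mul, eval_mul] at this
  rw [ratFun_eq]
  field_simp
  rw [this, mul_comm]

theorem denom_div_eval_ne_zero {p d : ℂ[X]} {t : ℂ} (ht : d.eval t ≠ 0) :
    (algebraMap ℂ[X] (RatFunc ℂ) p / algebraMap ℂ[X] (RatFunc ℂ) d).denom.eval t ≠ 0 := by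
  obtain ⟨c, hc⟩ := RatFunc.denom_div_dvd p d
  rw [hc, eval_mul] at ht
  exact left_ne_zero_of_mul ht

theorem exists_eq_C_mul_sq_sub {u : ℂ[X]} (hu : u.natDegree = 2) :
    ∃ a h δ : ℂ, u = C a * ((X + C h) ^ 2 - C δ) := by
  have ha : u.coeff 2 ≠ 0 := by
    rw [← hu]
    exact leadingCoeff_ne_zero.2 (ne_zero_of_natDegree_gt (n := 1) (by omega))
  have hu' := u.as_sum_range_C_mul_X_pow
  rw [hu, Finset.sum_range_succ, Finset.sum_range_succ, Finset.sum_range_one] at hu'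
  generalize u.coeff 0 = c, u.coeff 1 = b, u.coeff 2 = a at *
  refine ⟨a, b / (2 * a), (b / (2 * a)) ^ 2 - c / a, ?_⟩
  have h1 : b = 2 * a * (b / (2 * a)) := by field_simp
  have h2 : c = a * (c / a) := by field_simp
  have h1' := congrArg (C : ℂ → ℂ[X]) h1
  have h2' := congrArg (C : ℂ → ℂ[X]) h2
  rw [hu']
  simp only [map_mul, map_sub, map_pow, map_ofNat] at h1' h2' ⊢
  linear_combination X * h1' + h2'

theorem eval_ne_zero_of_hasDerivAt_mul {P : ℂ[X]} (hP : P ≠ 0) {g : ℂ → ℂ} {U : Set ℂ}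
    (hU : IsOpen U) (hg : DifferentiableOn ℂ g U)
    (hPg : ∀ t ∈ U, (derivative P).eval t = g t * P.eval t) {t : ℂ} (ht : t ∈ U) :
    P.eval t ≠ 0 := by
  intro h0
  obtain ⟨r, hr, hball⟩ := Metric.isOpen_iff.1 hU t ht
  have hz := eqOn_zero_of_hasDerivAt_mul Metric.isOpen_ball (convex_ball t r).isPreconnected
    (hg.mono hball) (F := fun t => P.eval t)
    (fun x hx => hPg x (hball hx) ▸ P.hasDerivAt x) (Metric.mem_ball_self hr) h0
  refine hP (eq_zero_of_infinite_isRoot P (Set.Infinite.mono (s := Metric.ball t r) hz ?_))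
  exact infinite_of_mem_nhds t (Metric.ball_mem_nhds t hr)

theorem exists_nat_params {q n : ℤ} (hn : Odd n) (hnq : |n| < 2 * |q|) :
    ∃ e k : ℕ, (q : ℂ) ^ 2 = ((e : ℂ) + k + 1) ^ 2 ∧ (n : ℂ) ^ 2 = (2 * (k : ℂ) + 1) ^ 2 := by
  obtain ⟨k, hk⟩ : Odd n.natAbs := Int.natAbs_odd.2 hn
  have hk' : |n| = 2 * (k : ℤ) + 1 := by rw [Int.abs_eq_natAbs, hk]; push_cast; rfl
  obtain ⟨e, he⟩ : ∃ e : ℕ, |q| = (e : ℤ) + k + 1 :=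
    ⟨(|q| - k - 1).toNat, by omega⟩
  refine ⟨e, k, ?_, ?_⟩
  · have : q ^ 2 = ((e : ℤ) + k + 1) ^ 2 := by rw [← he, sq_abs]
    exact_mod_cast this
  · have : n ^ 2 = (2 * (k : ℤ) + 1) ^ 2 := by rw [← hk', sq_abs]
    exact_mod_cast this

theorem mainTheorem5 (u : Polynomial ℂ) (hu : u.natDegree = 2) (q n : ℤ) (hq : q ^ 2 ≠ 1)
    (hn : Odd n) (hnq : |n| < 2 * |q|)
    (U : Set ℂ) (hUo : IsOpen U) (hUc : IsConnected U)
    (y : ℂ → ℂ) (hy : IsRiccatiSolutionOn q n u y U) :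
    ∃ R : RatFunc ℂ,
      Meromorphic (ratFun R) ∧
      Set.EqOn y (ratFun R) U ∧
      IsRiccatiSolutionOn q n u (ratFun R)
        {t : ℂ | u.eval t ≠ 0 ∧ R.denom.eval t ≠ 0} := by
  obtain ⟨e, k, hqe, hnk⟩ := exists_nat_params hn hnq
  obtain ⟨a, h, δ, hau⟩ := exists_eq_C_mul_sq_sub hu
  have hu0 : u ≠ 0 := ne_zero_of_natDegree_gt (n := 1) (by omega)
  obtain ⟨P₁, hm₁, hd₁, hP₁⟩ := exists_monic_gegenbauer h δ e (e + 2 * k + 1) ⟨e + k, by ring⟩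
  obtain ⟨P₂, hm₂, hd₂, hP₂⟩ := exists_monic_gegenbauer h δ (e + 2 * k + 1) e ⟨e + k, by ring⟩
  obtain ⟨t₀, ht₀⟩ := hUc.nonempty
  set s : ℂ := -((e : ℂ) + k) / 2 with hs
  set v : ℂ → ℂ := fun t => s * (derivative u).eval t / u.eval t with hv
  have hvd {t : ℂ} (ht : u.eval t ≠ 0) : DifferentiableAt ℂ v t :=
    ((derivative u).differentiableAt.const_mul s).div u.differentiableAt ht
  obtain ⟨P, hP0, hP, hPt₀⟩ : ∃ P : ℂ[X], P ≠ 0 ∧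
      ((X + C h) ^ 2 - C δ) * derivative (derivative P)
        - ((e : ℂ[X]) + ((e + 2 * k + 1 : ℕ) : ℂ[X]) - 1) * (X + C h) * derivative P
        + (e : ℂ[X]) * ((e + 2 * k + 1 : ℕ) : ℂ[X]) * P = 0 ∧
      (derivative P).eval t₀ + (y t₀ + v t₀) * P.eval t₀ = 0 := by
    set f₁ := (derivative P₁).eval t₀ + (y t₀ + v t₀) * P₁.eval t₀ with hf₁
    set f₂ := (derivative P₂).eval t₀ + (y t₀ + v t₀) * P₂.eval t₀ with hf₂
    by_cases h1 : f₁ = 0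
    · exact ⟨P₁, hm₁.ne_zero, hP₁, h1⟩
    -- Matches the initial value `y t₀`; nonzero because `P₂` has the larger degree.
    · refine ⟨C f₁ * P₂ - C f₂ * P₁, ?_, ?_, ?_⟩
      · intro hz
        have := congrArg natDegree (sub_eq_zero.1 hz)
        rw [natDegree_C_mul h1, hd₂] at this
        have := natDegree_C_mul_le f₂ P₁
        omega
      · simp only [derivative_sub, derivative_C_mul]
        linear_combination C f₁ * hP₂ - C f₂ * hP₁
      · simp only [derivative_sub, derivative_C_mul, eval_sub, eval_mul, eval_C]
        linear_combination f₂ * hf₁ - f₁ * hf₂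
  have hPP {t : ℂ} (ht : u.eval t ≠ 0) :=
    derivative_derivative_eval_of_gegenbauer hqe hnk hP hau ht
  have hF : Set.EqOn (fun t => (derivative P).eval t + (y t + v t) * P.eval t) 0 U :=
    eqOn_zero_of_hasDerivAt_mul hUo hUc.isPreconnected (g := fun t => y t - v t)
      (fun t ht => ((hy t ht).2.differentiableAt.sub (hvd (hy t ht).1)).differentiableWithinAt)
      (fun t ht => eval_add_mul_hasDerivAt (hy t ht).1 (hPP (hy t ht).1) (hy t ht).2) ht₀ hPt₀
  have hPU {t : ℂ} (ht : t ∈ U) : P.eval t ≠ 0 :=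
    eval_ne_zero_of_hasDerivAt_mul hP0 hUo (g := fun t => -(y t + v t))
      (fun t ht =>
        ((hy t ht).2.differentiableAt.add (hvd (hy t ht).1)).neg.differentiableWithinAt)
      (fun t ht => by
        have := hF ht
        simp only [Pi.zero_apply] at this
        linear_combination this) ht
  have hd : u * P ≠ 0 := mul_ne_zero hu0 hP0
  set R : RatFunc ℂ := algebraMap ℂ[X] (RatFunc ℂ)
    (-(C s * derivative u * P + derivative P * u)) / algebraMap ℂ[X] (RatFunc ℂ) (u * P) with hR
  have hRmul {t : ℂ} (ht : R.denom.eval t ≠ 0) : ratFun R t * (u.eval t * P.eval t) =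
      -(s * (derivative u).eval t * P.eval t + (derivative P).eval t * u.eval t) := by
    have := ratFun_div_mul hd ht
    simpa only [← hR, eval_mul, eval_neg, eval_add, eval_C] using this
  have hReq {t : ℂ} (ht : u.eval t ≠ 0) (hPt : P.eval t ≠ 0) :
      ratFun R t = -(s * (derivative u).eval t / u.eval t)
        - (derivative P).eval t / P.eval t := by
    have hden : R.denom.eval t ≠ 0 :=
      denom_div_eval_ne_zero (by rw [eval_mul]; exact mul_ne_zero ht hPt)
    have := hRmul hden
    field_simp
    linear_combination this
  refine ⟨R, meromorphic_ratFun R, fun t ht => ?_, fun t ht => ⟨ht.1, ?_⟩⟩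
  · have hPt := hPU ht
    have hFt := hF ht
    simp only [Pi.zero_apply] at hFt
    rw [hReq (hy t ht).1 hPt]
    change _ = -v t - _
    field_simp
    linear_combination hFt
  · have hWo : IsOpen {t : ℂ | u.eval t ≠ 0 ∧ R.denom.eval t ≠ 0} :=
      (isOpen_ne_fun u.continuous continuous_const).inter
        (isOpen_ne_fun R.denom.continuous continuous_const)
    -- A zero of `P` cannot cancel in the reduced form of `R`: where `R` is regular and `u ≠ 0`, `P'
    -- = -(R + v) P` would force `P = 0`.
    have hPt : P.eval t ≠ 0 :=
      eval_ne_zero_of_hasDerivAt_mul hP0 hWo (g := fun t => -(ratFun R t + v t))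
        (fun t ht =>
          ((differentiableAt_ratFun ht.2).add (hvd ht.1)).neg.differentiableWithinAt)
        (fun t ht => by
          have h1 := hRmul ht.2
          have h2 := ht.1
          simp only [hv]
          field_simp
          linear_combination h1) ht
    rw [hReq ht.1 hPt]
    refine (hasDerivAt_neg_logDeriv ht.1 hPt (hPP ht.1)).congr_of_eventuallyEq ?_
    filter_upwards [(isOpen_ne_fun u.continuous continuous_const).mem_nhds ht.1,
      (isOpen_ne_fun P.continuous continuous_const).mem_nhds hPt] with x hx hPx
    exact hReq hx hPx
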